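/- Let $\Omega\subset\mathbb{C}^n$ be a bounded domain and let $A(\Omega)$ be the completion, in the supremum norm over $\Omega$, of the algebra of functions holomorphic on a neighborhood of $\overline{\Omega}$. A Hilbert module over $A(\Omega)$ is a (complex, separable) Hilbert space $\mathcal{R}$ with a unital $A(\Omega)$-module structure satisfying $\|\psi f\|\le C\|\psi\|\,\|f\|$ for some constant $C$; it is contractive if $C=1$ is possible. Write $M_\psi$ for module multiplication by $\psi$. The module is essentially reductive if $M_\psi^*M_\psi-M_\psi M_\psi^*$ is compact for every $\psi\in A(\Omega)$, and reductive if every $M_\psi$ is normal. Theorem. Let $\mathcal{R}$ be an essentially reductive Hilbert module over $A(\Omega)$, and let $U$ be an isometric module map on $\mathcal{R}$ with $\bigcap_{k=0}^\infty U^k\mathcal{R}=(0)$. Then $\mathcal{R}$ is subnormal, that is, it is (isometrically isomorphic to) a submodule of a reductive Hilbert module $\mathcal{N}$ over $A(\Omega)$. More precisely, with $\mathcal{E}=\mathcal{R}\ominus U\mathcal{R}$, one can take for $\mathcal{N}$ the space $L^2_{\mathcal{E}}(\mathbb{T})$ with a reductive and contractive $A(\Omega)$-module structure, such that there are an isometric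 module map $\Psi:\mathcal{R}\to L^2_{\mathcal{E}}(\mathbb{T})$ and functions $\varphi_1,\dots,\varphi_n\in H^\infty_{\mathcal{L}(\mathcal{E})}(\mathbb{D})$ (identified with their boundary values on $\mathbb{T}$) with the following properties: the range of $\Psi$ is the Hardy space $H^2_{\mathcal{E}}(\mathbb{D})$; $\Psi U f=e^{it}\,\Psi f$ for all $f\in\mathcal{R}$; each coordinate function $z_i$ acts on $\mathcal{N}$ as the operator $L_{\varphi_i}$ of pointwise multiplication by $\varphi_i$; and for almost every $e^{it}\in\mathbb{T}$ the operators $\varphi_1(e^{it}),\dots,\varphi_n(e^{it})$ are normal and commute with one another. -/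

import Mathlib

open MeasureTheory

open scoped BoundedContinuousFunction

/-- A bounded domain (nonempty connected open set) in `ℂⁿ`. -/
structure BoundedDomain (n : ℕ) where
  carrier : Set (EuclideanSpace ℂ (Fin n))
  isOpen : IsOpen carrier
  isConnected : IsConnected carrier
  isBounded : Bornology.IsBounded carrier

/-- The restrictions to `Ω` of the functions that are holomorphic on some open neighbourhood of the
closure of `Ω`, inside the bounded continuous functions on `Ω` with the supremum norm. -/
def holomorphicNearClosure {n : ℕ} (Ω : BoundedDomain n) : Subalgebra ℂ (Ω.carrier →ᵇ ℂ) where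
  carrier := {f | ∃ (V : Set (EuclideanSpace ℂ (Fin n))) (F : EuclideanSpace ℂ (Fin n) → ℂ),
    IsOpen V ∧ closure Ω.carrier ⊆ V ∧ DifferentiableOn ℂ F V ∧ ∀ z : Ω.carrier, f z = F z}
  mul_mem' := by
    rintro f g ⟨V, F, hV, hΩV, hF, hf⟩ ⟨W, G, hW, hΩW, hG, hg⟩
    exact ⟨V ∩ W, fun z => F z * G z, hV.inter hW, Set.subset_inter hΩV hΩW,
      (hF.mono Set.inter_subset_left).mul (hG.mono Set.inter_subset_right),
      fun z => by simp [hf z, hg z]⟩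
  add_mem' := by
    rintro f g ⟨V, F, hV, hΩV, hF, hf⟩ ⟨W, G, hW, hΩW, hG, hg⟩
    exact ⟨V ∩ W, fun z => F z + G z, hV.inter hW, Set.subset_inter hΩV hΩW,
      (hF.mono Set.inter_subset_left).add (hG.mono Set.inter_subset_right),
      fun z => by simp [hf z, hg z]⟩
  algebraMap_mem' := fun c =>
    ⟨Set.univ, fun _ => c, isOpen_univ, Set.subset_univ _, differentiableOn_const c,
      fun z => by simp [BoundedContinuousFunction.algebraMap_apply]⟩

/-- The algebra `A(Ω)`: the completion, in the supremum norm over `Ω`, of the algebra of functions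
holomorphic on a neighbourhood of the closure of `Ω`. -/
noncomputable abbrev DomainAlgebra {n : ℕ} (Ω : BoundedDomain n) : Subalgebra ℂ (Ω.carrier →ᵇ ℂ) :=
  (holomorphicNearClosure Ω).topologicalClosure

/-- The coordinate function `z ↦ zᵢ` as a bounded continuous function on `Ω`. -/
noncomputable def coordBCF {n : ℕ} (Ω : BoundedDomain n) (i : Fin n) : Ω.carrier →ᵇ ℂ :=
  BoundedContinuousFunction.ofNormedAddCommGroup (fun z : Ω.carrier => (z : EuclideanSpace ℂ (Fin n)) i)
    (by fun_prop) Ω.isBounded.exists_norm_le.choose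
    (fun z => (PiLp.norm_apply_le (z : EuclideanSpace ℂ (Fin n)) i).trans
      (Ω.isBounded.exists_norm_le.choose_spec z z.2))

/-- The coordinate function `zᵢ` as an element of `A(Ω)`. -/
noncomputable def coord {n : ℕ} (Ω : BoundedDomain n) (i : Fin n) : DomainAlgebra Ω :=
  ⟨coordBCF Ω i, (holomorphicNearClosure Ω).le_topologicalClosure
    ⟨Set.univ, fun z => z i, isOpen_univ, Set.subset_univ _,
      by fun_prop, fun _ => rfl⟩⟩

/-- A Hilbert module over `A(Ω)` on the Hilbert space `H`: a unital module action of `A(Ω)` that is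
bounded, `‖φ f‖ ≤ C ‖φ‖ ‖f‖`. The operator `M_φ` of module multiplication by `φ` is `act φ`. -/
structure HilbertModule {n : ℕ} (Ω : BoundedDomain n) (H : Type*) [NormedAddCommGroup H]
    [InnerProductSpace ℂ H] where
  act : DomainAlgebra Ω →ₐ[ℂ] (H →L[ℂ] H)
  bounded : ∃ C : ℝ, ∀ φ : DomainAlgebra Ω, ‖act φ‖ ≤ C * ‖φ‖

namespace HilbertModule

/-- The module is contractive: `‖φ f‖ ≤ ‖φ‖ ‖f‖`. -/
def IsContractive {n : ℕ} {Ω : BoundedDomain n} {H : Type*} [NormedAddCommGroup H]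
    [InnerProductSpace ℂ H] (M : HilbertModule Ω H) : Prop :=
  ∀ (φ : DomainAlgebra Ω) (f : H), ‖M.act φ f‖ ≤ ‖φ‖ * ‖f‖

/-- The module is reductive: every module multiplication operator is normal. -/
def IsReductive {n : ℕ} {Ω : BoundedDomain n} {H : Type*} [NormedAddCommGroup H]
    [InnerProductSpace ℂ H] [CompleteSpace H] (M : HilbertModule Ω H) : Prop :=
  ∀ φ : DomainAlgebra Ω, IsStarNormal (M.act φ)

/-- The module is essentially reductive: every self-commutator `M_φ^* M_φ - M_φ M_φ^*` is compact. -/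
def IsEssentiallyReductive {n : ℕ} {Ω : BoundedDomain n} {H : Type*} [NormedAddCommGroup H]
    [InnerProductSpace ℂ H] [CompleteSpace H] (M : HilbertModule Ω H) : Prop :=
  ∀ φ : DomainAlgebra Ω, IsCompactOperator
    (ContinuousLinearMap.adjoint (M.act φ) * M.act φ
      - M.act φ * ContinuousLinearMap.adjoint (M.act φ) : H →L[ℂ] H)

/-- The linear isometry `V` between Hilbert modules is a module map. -/
def IsModuleMap {n : ℕ} {Ω : BoundedDomain n} {H K : Type*} [NormedAddCommGroup H]
    [InnerProductSpace ℂ H] [NormedAddCommGroup K] [InnerProductSpace ℂ K]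
    (M : HilbertModule Ω H) (N : HilbertModule Ω K) (V : H →ₗᵢ[ℂ] K) : Prop :=
  ∀ (φ : DomainAlgebra Ω) (f : H), V (M.act φ f) = N.act φ (V f)

end HilbertModule

instance fact_two_pi_pos : Fact (0 < 2 * Real.pi) := ⟨Real.two_pi_pos⟩

/-- The circle, the parameter `t` standing for the point `e^{it}`. -/
abbrev Torus : Type := AddCircle (2 * Real.pi)

/-- Normalized Lebesgue measure on the circle. -/
noncomputable abbrev torusMeasure : Measure Torus := AddCircle.haarAddCircle

/-- The Hilbert space `L²_E(𝕋)`. -/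
noncomputable abbrev L2Torus (E : Type*) [NormedAddCommGroup E] : Type _ :=
  Lp E 2 torusMeasure

/-- Membership in the vector-valued Hardy space `H²_E(𝔻)`, viewed inside `L²_E(𝕋)`: the Fourier
coefficients of negative index vanish. -/
def IsHardy {E : Type*} [NormedAddCommGroup E] [InnerProductSpace ℂ E] (f : L2Torus E) : Prop :=
  ∀ m : ℤ, m < 0 → fourierCoeff (f : Torus → E) m = 0

/-- Membership in `H^∞_{L(E)}(𝔻)`, viewed through boundary values on `𝕋`: a strongly measurable,
essentially bounded operator-valued function whose Fourier coefficients of negative index vanish. -/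
structure IsHInfty {E : Type*} [NormedAddCommGroup E] [InnerProductSpace ℂ E]
    (φ : Torus → E →L[ℂ] E) : Prop where
  measurable : ∀ x : E, AEStronglyMeasurable (fun t => φ t x) torusMeasure
  bounded : ∃ C : ℝ, ∀ᵐ t ∂torusMeasure, ‖φ t‖ ≤ C
  analytic : ∀ (x : E) (m : ℤ), m < 0 → fourierCoeff (fun t => φ t x) m = 0

/-- `T` is the Laurent operator `L_φ` of pointwise multiplication by `φ` on `L²_E(𝕋)`. -/
def IsLaurent {E : Type*} [NormedAddCommGroup E] [InnerProductSpace ℂ E]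
    (φ : Torus → E →L[ℂ] E) (T : L2Torus E →L[ℂ] L2Torus E) : Prop :=
  ∀ f : L2Torus E, (T f : Torus → E) =ᵐ[torusMeasure] fun t => φ t (f t)

/-- The wandering subspace `E = H ⊖ U H` of an isometry `U` on `H`. -/
noncomputable abbrev wanderingSubspace {H : Type*} [NormedAddCommGroup H] [InnerProductSpace ℂ H]
    (U : H →ₗᵢ[ℂ] H) : Submodule ℂ H :=
  (LinearMap.range U.toLinearMap)ᗮ

/-! A pure isometry is a shift: the Hilbert space is the orthogonal sum of the subspaces `U^k E`,
and sending `U^k e` to `e^{ikt} e` identifies it with the Hardy space (`exists_wold_isometry`). The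
translates `e^{-imt} Ψ H` increase to a dense subspace of `L²` (`dense_negShifts`), so an operator
`T` commuting with `U` has exactly one extension `L` with `L (e^{-imt} Ψ h) = e^{-imt} Ψ (T h)`
(`exists_isShiftExtension`). Uniqueness makes `T ↦ L` respect sums and products, so the whole module
structure extends.

Essential normality of `T` becomes normality of `L` (`IsShiftExtension.isStarNormal`). Indeed `‖T
U^k h‖ = ‖L Ψ h‖` for every `k`, while `‖T^* U^k h‖` tends to `‖L^* Ψ h‖`. Since `U^k h` tends
weakly to zero, the compact self-commutator forces the two limits to agree. Contractivity is then
automatic, because norm and spectral radius coincide on normal operators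
(`norm_map_le_of_isStarNormal`).

Finally, an operator commuting with `e^{it}` is multiplication by an operator-valued symbol, found
by Lebesgue differentiation (`exists_symbol`, `isLaurent_of_symbol`). Commutation and normality
descend to almost every value of the symbols, and analyticity holds because the extensions preserve
the Hardy space. -/

open Filter Topology ContinuousLinearMap

/-! ### Multiplication by characters and Fourier coefficients in `L²_E(𝕋)`. -/

section FourierMultiplication

theorem norm_fourier_apply (m : ℤ) (t : Torus) : ‖fourier m t‖ = 1 :=
  Circle.norm_coe _

variable {E : Type*} [NormedAddCommGroup E] [InnerProductSpace ℂ E]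

theorem memLp_fourier_smul (m : ℤ) (f : L2Torus E) :
    MemLp (fun t => fourier m t • f t) 2 torusMeasure := by
  refine (Lp.memLp f).of_le ?_ ?_
  · exact (fourier m).continuous.aestronglyMeasurable.smul (Lp.aestronglyMeasurable f)
  · refine Eventually.of_forall fun t => ?_
    rw [norm_smul, norm_fourier_apply, one_mul]

/-- Multiplication by `e^{imt}` on `L²_E(𝕋)`. -/
noncomputable def fourierMul (m : ℤ) : L2Torus E →ₗᵢ[ℂ] L2Torus E where
  toFun f := (memLp_fourier_smul m f).toLp
  map_add' f g := by
    ext1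
    filter_upwards [MemLp.coeFn_toLp (memLp_fourier_smul m (f + g)),
      MemLp.coeFn_toLp (memLp_fourier_smul m f), MemLp.coeFn_toLp (memLp_fourier_smul m g),
      Lp.coeFn_add f g,
      Lp.coeFn_add (memLp_fourier_smul m f).toLp (memLp_fourier_smul m g).toLp]
      with t h1 h2 h3 h4 h5
    rw [h1, h4, h5, Pi.add_apply, Pi.add_apply, h2, h3, smul_add]
  map_smul' c f := by
    ext1
    filter_upwards [MemLp.coeFn_toLp (memLp_fourier_smul m (c • f)),
      MemLp.coeFn_toLp (memLp_fourier_smul m f), Lp.coeFn_smul c f,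
      Lp.coeFn_smul c (memLp_fourier_smul m f).toLp] with t h1 h2 h3 h4
    rw [RingHom.id_apply, h1, h3, h4, Pi.smul_apply, Pi.smul_apply, h2, smul_comm]
  norm_map' f := by
    refine le_antisymm (Lp.norm_le_norm_of_ae_le ?_) (Lp.norm_le_norm_of_ae_le ?_) <;>
    · filter_upwards [MemLp.coeFn_toLp (memLp_fourier_smul m f)] with t h
      simp only [LinearMap.coe_mk, AddHom.coe_mk, h]
      rw [norm_smul, norm_fourier_apply, one_mul]

theorem coeFn_fourierMul (m : ℤ) (f : L2Torus E) :
    fourierMul m f =ᵐ[torusMeasure] fun t => fourier m t • f t :=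
  MemLp.coeFn_toLp (memLp_fourier_smul m f)

@[simp]
theorem fourierMul_zero (f : L2Torus E) : fourierMul 0 f = f := by
  ext1
  filter_upwards [coeFn_fourierMul 0 f] with t h
  simp [h]

theorem fourierMul_add (m n : ℤ) (f : L2Torus E) :
    fourierMul (m + n) f = fourierMul m (fourierMul n f) := by
  ext1
  filter_upwards [coeFn_fourierMul (m + n) f, coeFn_fourierMul n f,
    coeFn_fourierMul m (fourierMul n f)] with t h1 h2 h3
  rw [h1, h3, h2, fourier_add, mul_smul]

@[simp]
theorem fourierMul_neg_fourierMul (m : ℤ) (f : L2Torus E) :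
    fourierMul (-m) (fourierMul m f) = f := by
  rw [← fourierMul_add]; simp

@[simp]
theorem fourierMul_fourierMul_neg (m : ℤ) (f : L2Torus E) :
    fourierMul m (fourierMul (-m) f) = f := by
  rw [← fourierMul_add]; simp

theorem inner_fourierMul_left (m : ℤ) (f g : L2Torus E) :
    inner ℂ (fourierMul m f) g = inner ℂ f (fourierMul (-m) g) := by
  rw [← (fourierMul (-m)).inner_map_map, fourierMul_neg_fourierMul]

/-- The constant functions in `L²_E(𝕋)`. -/
noncomputable def torusConst (E : Type*) [NormedAddCommGroup E] [InnerProductSpace ℂ E] :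
    E →ₗᵢ[ℂ] L2Torus E where
  toLinearMap := Lp.constₗ 2 torusMeasure ℂ
  norm_map' x := by
    simp [Lp.norm_const' (p := 2) (μ := torusMeasure) (c := x)]

theorem coeFn_torusConst (x : E) : torusConst E x =ᵐ[torusMeasure] fun _ => x :=
  Lp.coeFn_const 2 torusMeasure x

/-- The functions `e^{ikt} x` in `L²_E(𝕋)`. -/
noncomputable def torusMonomial (k : ℤ) : E →ₗᵢ[ℂ] L2Torus E :=
  (fourierMul k).comp (torusConst E)

theorem coeFn_torusMonomial (k : ℤ) (x : E) :
    torusMonomial k x =ᵐ[torusMeasure] fun t => fourier k t • x := by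
  filter_upwards [coeFn_fourierMul k (torusConst E x), coeFn_torusConst x] with t h1 h2
  rw [h2] at h1
  exact h1

theorem fourierMul_torusMonomial (m k : ℤ) (x : E) :
    fourierMul m (torusMonomial k x) = torusMonomial (m + k) x := by
  simp [torusMonomial, fourierMul_add]

theorem integrable_coeFn {E : Type*} [NormedAddCommGroup E] (f : L2Torus E) : Integrable f torusMeasure :=
  (Lp.memLp f).integrable one_le_two

variable [CompleteSpace E]

theorem inner_torusMonomial (k : ℤ) (x : E) (f : L2Torus E) :
    inner ℂ (torusMonomial k x) f = inner ℂ x (fourierCoeff (f : Torus → E) k) := by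
  rw [L2.inner_def, fourierCoeff, ← integral_inner]
  · refine integral_congr_ae ?_
    filter_upwards [coeFn_torusMonomial k x] with t h
    rw [h, inner_smul_left, inner_smul_right, fourier_neg]
  · exact (integrable_coeFn f).fourier_smul _

theorem fourierCoeff_sub_coeFn (f g : L2Torus E) (k : ℤ) :
    fourierCoeff (f - g : L2Torus E) k
      = fourierCoeff (f : Torus → E) k - fourierCoeff (g : Torus → E) k := by
  refine ext_inner_left ℂ fun x => ?_
  rw [inner_sub_right, ← inner_torusMonomial, ← inner_torusMonomial, ← inner_torusMonomial,
    inner_sub_right]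

theorem inner_torusMonomial_torusMonomial_of_ne {k l : ℤ} (h : k ≠ l) (x y : E) :
    inner ℂ (torusMonomial k x) (torusMonomial l y) = 0 := by
  rw [inner_torusMonomial, fourierCoeff_congr_ae (coeFn_torusMonomial l y)]
  have : fourierCoeff (fun t : Torus => fourier l t • y) k = 0 := by
    have h1 : fourierCoeff (fun t : Torus => fourier l t • y) k
        = ∫ t : Torus, fourier (l - k) t • y ∂torusMeasure := by
      refine integral_congr_ae (Eventually.of_forall fun t => ?_)
      simp only []
      rw [smul_smul, ← fourier_add]
      congr 2
      ring_nf
    rw [h1, integral_smul_const]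
    have h2 : ∫ t : Torus, fourier (l - k) t ∂torusMeasure = fourierCoeff (fourier (l - k) : Torus → ℂ) 0 := by
      simp [fourierCoeff]
    rw [h2, fourierCoeff_fourier, Pi.single_eq_of_ne (by omega), zero_smul]
  rw [this, inner_zero_right]

theorem orthogonalFamily_torusMonomial :
    OrthogonalFamily ℂ (fun _ : ℤ => E) fun k => torusMonomial k :=
  fun _ _ h x y => inner_torusMonomial_torusMonomial_of_ne h x y

end FourierMultiplication

/-! ### Uniqueness of Fourier coefficients and strong limits of operators. -/

/-- An integrable function on the circle all of whose Fourier coefficients vanish is zero. -/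
theorem ae_eq_zero_of_fourierCoeff_eq_zero {a : Torus → ℂ} (ha : Integrable a torusMeasure)
    (h : ∀ m : ℤ, fourierCoeff a m = 0) : a =ᵐ[torusMeasure] 0 := by
  have hint : ∀ g : C(Torus, ℂ), Integrable (fun t => g t * a t) torusMeasure := fun g =>
    ha.bdd_mul g.continuous.aestronglyMeasurable (c := ‖g‖)
      (Eventually.of_forall fun t => g.norm_coe_le_norm t)
  let Λ : C(Torus, ℂ) →ₗ[ℂ] ℂ :=
    { toFun := fun g => ∫ t, g t * a t ∂torusMeasure
      map_add' := fun g g' => by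
        simp only [ContinuousMap.add_apply, add_mul]
        exact integral_add (hint g) (hint g')
      map_smul' := fun c g => by
        simp only [ContinuousMap.smul_apply, smul_eq_mul, mul_assoc, RingHom.id_apply]
        exact integral_const_mul _ _ }
  have hΛ : Continuous Λ := by
    refine (Λ.mkContinuous (∫ t, ‖a t‖ ∂torusMeasure) fun g => ?_).continuous
    calc ‖∫ t, g t * a t ∂torusMeasure‖ ≤ ∫ t, ‖a t‖ * ‖g‖ ∂torusMeasure := by
          refine norm_integral_le_of_norm_le (ha.norm.mul_const _)
            (Eventually.of_forall fun t => ?_)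
          rw [norm_mul, mul_comm]
          exact mul_le_mul_of_nonneg_left (g.norm_coe_le_norm t) (norm_nonneg _)
      _ = _ := integral_mul_const _ _
  have hcont : ∀ g : C(Torus, ℂ), ∫ t, g t * a t ∂torusMeasure = 0 := by
    intro g
    -- Integration against `a` is a continuous functional on `C(𝕋)` that kills every character, and
    -- trigonometric polynomials are dense.
    have hle : (Submodule.span ℂ (Set.range (fourier : ℤ → C(Torus, ℂ)))).topologicalClosure
        ≤ LinearMap.ker Λ := by
      refine Submodule.topologicalClosure_minimal _ (Submodule.span_le.2 ?_) ?_
      · rintro _ ⟨m, rfl⟩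
        have := h (-m)
        simpa [fourierCoeff, Λ] using this
      · exact isClosed_singleton.preimage hΛ
    rw [span_fourier_closure_eq_top] at hle
    exact hle (Submodule.mem_top (x := g))
  refine ae_eq_zero_of_forall_setIntegral_isClosed_eq_zero ha fun s hs => ?_
  -- The indicator of a closed set is a bounded pointwise limit of continuous functions, so
  -- dominated convergence carries the vanishing over to closed sets.
  obtain ⟨u, -, hu0, hu⟩ := exists_seq_strictAnti_tendsto (0 : ℝ)
  have hlim := thickenedIndicator_tendsto_indicator_closure hu0 hu s
  rw [hs.closure_eq, tendsto_pi_nhds] at hlim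
  have key : Tendsto (fun n => ∫ t, ((thickenedIndicator (hu0 n) s t : ℝ) : ℂ) * a t ∂torusMeasure)
      atTop (𝓝 (∫ t, s.indicator a t ∂torusMeasure)) := by
    refine tendsto_integral_of_dominated_convergence (fun t => ‖a t‖) (fun n => ?_) ha.norm
      (fun n => Eventually.of_forall fun t => ?_) (Eventually.of_forall fun t => ?_)
    · refine AEStronglyMeasurable.mul (Continuous.aestronglyMeasurable ?_) ha.1
      exact Complex.continuous_ofReal.comp
        (NNReal.continuous_coe.comp (thickenedIndicator (hu0 n) s).continuous)
    · rw [norm_mul]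
      refine mul_le_of_le_one_left (norm_nonneg _) ?_
      simpa using thickenedIndicator_le_one (hu0 n) s t
    · have h1 : Tendsto (fun n => ((thickenedIndicator (hu0 n) s t : ℝ) : ℂ) * a t) atTop
          (𝓝 ((((s.indicator (fun _ => (1 : NNReal)) t : NNReal) : ℝ) : ℂ) * a t)) :=
        (((Complex.continuous_ofReal.comp NNReal.continuous_coe).tendsto
          (s.indicator (fun _ => (1 : NNReal)) t)).comp (hlim t)).mul_const (a t)
      convert h1 using 2
      by_cases ht : t ∈ s <;> simp [ht]
  rw [← integral_indicator hs.measurableSet]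
  refine tendsto_nhds_unique key ?_
  refine tendsto_const_nhds.congr fun n => ?_
  exact (hcont ⟨fun t => ((thickenedIndicator (hu0 n) s t : ℝ) : ℂ),
    Complex.continuous_ofReal.comp
      (NNReal.continuous_coe.comp (thickenedIndicator (hu0 n) s).continuous)⟩).symm

/-- A uniformly bounded sequence of operators that converges pointwise on a dense set converges
strongly to a bounded operator. -/
theorem exists_clm_tendsto_of_dense {X Y : Type*} [NormedAddCommGroup X] [NormedSpace ℂ X]
    [NormedAddCommGroup Y] [NormedSpace ℂ Y] [CompleteSpace Y] {A : ℕ → X →L[ℂ] Y} {C : ℝ}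
    (hA : ∀ n, ‖A n‖ ≤ C) {s : Set X} (hs : Dense s)
    (h : ∀ x ∈ s, ∃ y, Tendsto (fun n => A n x) atTop (𝓝 y)) :
    ∃ B : X →L[ℂ] Y, ‖B‖ ≤ C ∧ ∀ x, Tendsto (fun n => A n x) atTop (𝓝 (B x)) := by
  have hC : 0 ≤ C := (norm_nonneg _).trans (hA 0)
  have hcauchy : ∀ x, ∃ y, Tendsto (fun n => A n x) atTop (𝓝 y) := by
    intro x
    refine cauchySeq_tendsto_of_complete (Metric.cauchySeq_iff'.2 fun ε hε => ?_)
    -- The constant `C + 1` replaces `C` to avoid division by zero.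
    obtain ⟨z, hz, hxz⟩ := hs.exists_dist_lt x (show 0 < ε / (3 * (C + 1)) by positivity)
    obtain ⟨y, hy⟩ := h z hz
    obtain ⟨N, hN⟩ := Metric.cauchySeq_iff'.1 hy.cauchySeq (ε / 3) (by positivity)
    have hsmall : ∀ n, dist (A n x) (A n z) < ε / 3 := fun n => by
      rw [dist_eq_norm, ← map_sub]
      calc ‖A n (x - z)‖ ≤ C * ‖x - z‖ := (A n).le_of_opNorm_le (hA n) _
        _ ≤ (C + 1) * ‖x - z‖ := by gcongr; linarith
        _ < (C + 1) * (ε / (3 * (C + 1))) := by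
          rw [← dist_eq_norm]; gcongr
        _ = ε / 3 := by field_simp
    refine ⟨N, fun n hn => ?_⟩
    have h1 := hsmall n
    have h2 := hsmall N
    have h3 := hN n hn
    have h4 := dist_triangle4 (A n x) (A n z) (A N z) (A N x)
    rw [dist_comm (A N z)] at h4
    linarith
  choose B hB using hcauchy
  refine ⟨LinearMap.mkContinuous
    { toFun := B
      map_add' := fun x y => tendsto_nhds_unique (hB (x + y))
        (((hB x).add (hB y)).congr fun n => by simp)
      map_smul' := fun c x => tendsto_nhds_unique (hB (c • x))
        (((hB x).const_smul c).congr fun n => by simp) } C fun x => ?_, ?_, hB⟩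
  · exact le_of_tendsto (hB x).norm
      (Eventually.of_forall fun n => (A n).le_of_opNorm_le (hA n) x)
  · exact LinearMap.mkContinuous_norm_le _ hC _

/-- Lebesgue differentiation is applied to `volume`, the statements concern normalized measure; the
two differ by a positive factor. -/
theorem ae_volume_torus : ae (volume : Measure Torus) = ae torusMeasure := by
  rw [AddCircle.volume_eq_smul_haarAddCircle]
  exact Measure.ae_ennreal_smul_measure_eq (ENNReal.ofReal_pos.2 Real.two_pi_pos).ne' _

theorem MeasureTheory.Integrable.volume_torus {F : Type*} [NormedAddCommGroup F] {f : Torus → F}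
    (hf : Integrable f torusMeasure) : Integrable f := by
  rw [AddCircle.volume_eq_smul_haarAddCircle]
  exact hf.smul_measure ENNReal.ofReal_ne_top

/-! ### Operators commuting with `e^{it}` and their symbols. -/

section Laurent

variable {E : Type*} [NormedAddCommGroup E] [InnerProductSpace ℂ E]

theorem inner_fourierMul_left_eq_fourierCoeff (m : ℤ) (f g : L2Torus E) :
    inner ℂ (fourierMul m f) g = fourierCoeff (fun t => inner ℂ (f t) (g t)) m := by
  rw [L2.inner_def, fourierCoeff]
  refine integral_congr_ae ?_
  filter_upwards [coeFn_fourierMul m f] with t h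
  rw [h, inner_smul_left, fourier_neg, smul_eq_mul]

theorem ae_eq_of_forall_inner_left [SecondCountableTopology E] {f g : Torus → E}
    (h : ∀ y : E, ∀ᵐ t ∂torusMeasure, inner ℂ (f t) y = inner ℂ (g t) y) :
    f =ᵐ[torusMeasure] g := by
  have : (fun t => f t - g t) =ᵐ[torusMeasure] 0 := by
    refine ae_eq_zero_of_forall_inner (𝕜 := ℂ) fun y => ?_
    filter_upwards [h y] with t ht
    rw [inner_sub_right, ← inner_conj_symm, ht, inner_conj_symm, sub_self, Pi.zero_apply]
  filter_upwards [this] with t ht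
  exact sub_eq_zero.1 ht

theorem norm_sq_eq_integral (f : L2Torus E) : ‖f‖ ^ 2 = ∫ t, ‖f t‖ ^ 2 ∂torusMeasure := by
  have h : ((‖f‖ ^ 2 : ℝ) : ℂ) = ((∫ t, ‖f t‖ ^ 2 ∂torusMeasure : ℝ) : ℂ) := by
    rw [← integral_complex_ofReal]
    have := L2.inner_def (𝕜 := ℂ) f f
    rw [inner_self_eq_norm_sq_to_K] at this
    push_cast
    refine this.trans (integral_congr_ae (Eventually.of_forall fun t => ?_))
    exact inner_self_eq_norm_sq_to_K _
  exact_mod_cast h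

theorem commute_fourierMul {L : L2Torus E →L[ℂ] L2Torus E}
    (hL : ∀ f, L (fourierMul 1 f) = fourierMul 1 (L f)) (m : ℤ) (f : L2Torus E) :
    L (fourierMul m f) = fourierMul m (L f) := by
  induction m using Int.induction_on generalizing f with
  | zero => simp
  | succ k ih => rw [fourierMul_add, ih, hL, ← fourierMul_add]
  | pred k ih =>
    have h1 : ∀ g, L (fourierMul (-1) g) = fourierMul (-1) (L g) := fun g => by
      rw [← fourierMul_neg_fourierMul 1 (L (fourierMul (-1) g)), ← hL, fourierMul_fourierMul_neg]
    rw [sub_eq_add_neg, fourierMul_add, ih, h1, ← fourierMul_add]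

variable [CompleteSpace E]

theorem adjoint_commute_fourierMul {L : L2Torus E →L[ℂ] L2Torus E}
    (hL : ∀ f, L (fourierMul 1 f) = fourierMul 1 (L f)) (m : ℤ) (f : L2Torus E) :
    adjoint L (fourierMul m f) = fourierMul m (adjoint L f) := by
  refine ext_inner_right ℂ fun g => ?_
  rw [adjoint_inner_left, inner_fourierMul_left, inner_fourierMul_left, adjoint_inner_left,
    commute_fourierMul hL]

/-- An operator commuting with multiplication by `e^{it}` and its adjoint are adjoint to each other
pointwise. -/
theorem ae_inner_apply_eq_inner_adjoint {L : L2Torus E →L[ℂ] L2Torus E}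
    (hL : ∀ f, L (fourierMul 1 f) = fourierMul 1 (L f)) (u v : L2Torus E) :
    ∀ᵐ t ∂torusMeasure, inner ℂ (L u t) (v t) = inner ℂ (u t) (adjoint L v t) := by
  have hi1 := L2.integrable_inner (𝕜 := ℂ) (L u) v
  have hi2 := L2.integrable_inner (𝕜 := ℂ) u (adjoint L v)
  -- The `m`-th Fourier coefficients of the two sides are `⟨e^{imt} L u, v⟩` and `⟨L (e^{imt} u),
  -- v⟩`, which agree because `L` commutes with `e^{imt}`.
  have := ae_eq_zero_of_fourierCoeff_eq_zero (hi1.sub hi2) fun m => by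
    rw [sub_eq_add_neg, fourierCoeff.add hi1 hi2.neg, Pi.add_apply,
      show (-fun t => inner ℂ (u t) (adjoint L v t) : Torus → ℂ)
        = (-1 : ℂ) • fun t => inner ℂ (u t) (adjoint L v t) by ext; simp,
      fourierCoeff.const_smul, ← inner_fourierMul_left_eq_fourierCoeff,
      ← inner_fourierMul_left_eq_fourierCoeff, adjoint_inner_right, commute_fourierMul hL]
    simp
  filter_upwards [this] with t ht
  exact sub_eq_zero.1 ht

variable [SecondCountableTopology E]

/-- `L` commutes with restriction to a measurable set `s`, so the integral of `‖L x‖²` over `s` is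
`‖L (1_s x)‖²`, at most `‖L‖² ‖x‖²` times the measure of `s`. As `s` is arbitrary, the bound holds
pointwise. -/
theorem ae_norm_apply_torusConst_le {L : L2Torus E →L[ℂ] L2Torus E}
    (hL : ∀ f, L (fourierMul 1 f) = fourierMul 1 (L f)) (x : E) :
    ∀ᵐ t ∂torusMeasure, ‖L (torusConst E x) t‖ ≤ ‖L‖ * ‖x‖ := by
  have key : (fun t => ‖L (torusConst E x) t‖ ^ 2) ≤ᵐ[torusMeasure]
      fun _ => (‖L‖ * ‖x‖) ^ 2 := by
    refine ae_le_of_forall_setIntegral_le (Lp.memLp _).norm.integrable_sq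
      (integrable_const _) fun s hs hμs => ?_
    let w : L2Torus E := indicatorConstLp 2 hs hμs.ne x
    have hw : L w =ᵐ[torusMeasure] s.indicator (L (torusConst E x)) := by
      refine ae_eq_of_forall_inner_left fun y => ?_
      filter_upwards [ae_inner_apply_eq_inner_adjoint hL w (torusConst E y),
        ae_inner_apply_eq_inner_adjoint hL (torusConst E x) (torusConst E y),
        coeFn_torusConst x, coeFn_torusConst y,
        indicatorConstLp_coeFn (p := 2) (hs := hs) (hμs := hμs.ne) (c := x)] with t h1 h2 h3 h4 h5
      rw [h4, h5] at h1
      rw [h3, h4] at h2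
      rw [h1]
      by_cases ht : t ∈ s <;> simp [ht, h2]
    have hLw : ∫ t in s, ‖L (torusConst E x) t‖ ^ 2 ∂torusMeasure = ‖L w‖ ^ 2 := by
      rw [norm_sq_eq_integral, ← integral_indicator hs]
      refine integral_congr_ae ?_
      filter_upwards [hw] with t ht
      rw [ht]
      by_cases hts : t ∈ s <;> simp [hts]
    have hwn : ‖w‖ ^ 2 = ‖x‖ ^ 2 * torusMeasure.real s := by
      rw [norm_indicatorConstLp two_ne_zero ENNReal.ofNat_ne_top, mul_pow,
        ← Real.rpow_natCast (torusMeasure.real s ^ _), ← Real.rpow_mul measureReal_nonneg]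
      norm_num
    rw [hLw, setIntegral_const, smul_eq_mul]
    calc ‖L w‖ ^ 2 ≤ (‖L‖ * ‖w‖) ^ 2 := by gcongr; exact L.le_opNorm w
      _ = _ := by rw [mul_pow, hwn]; ring
  filter_upwards [key] with t ht
  exact le_of_sq_le_sq ht (by positivity)

/-- The average of `x ↦ L (1 ⊗ x)` over a ball, for an operator `L` commuting with multiplication
by `e^{it}`. -/
theorem exists_clm_eq_average {L : L2Torus E →L[ℂ] L2Torus E}
    (hL : ∀ f, L (fourierMul 1 f) = fourierMul 1 (L f)) (s : Set Torus) :
    ∃ A : E →L[ℂ] E, ‖A‖ ≤ ‖L‖ ∧ ∀ x, A x = ⨍ t in s, L (torusConst E x) t := by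
  have hint : ∀ f : L2Torus E, IntegrableOn f s :=
    fun f => (integrable_coeFn f).volume_torus.integrableOn
  refine ⟨LinearMap.mkContinuous
    { toFun := fun x => ⨍ t in s, L (torusConst E x) t
      map_add' := fun x y => ?_
      map_smul' := fun c x => ?_ } ‖L‖ fun x => ?_,
    LinearMap.mkContinuous_norm_le _ (norm_nonneg _) _, fun x => rfl⟩
  · simp only [setAverage_eq]
    rw [← smul_add, ← integral_add (hint _) (hint _)]
    congr 1
    refine integral_congr_ae (ae_restrict_of_ae ?_)
    rw [map_add, map_add]
    filter_upwards [ae_volume_torus ▸ Lp.coeFn_add (L (torusConst E x)) (L (torusConst E y))]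
      with t ht
    rw [ht, Pi.add_apply]
  · simp only [setAverage_eq, RingHom.id_apply]
    rw [smul_comm c, ← integral_smul c]
    congr 1
    refine integral_congr_ae (ae_restrict_of_ae ?_)
    rw [map_smul, map_smul]
    filter_upwards [ae_volume_torus ▸ Lp.coeFn_smul c (L (torusConst E x))] with t ht
    rw [ht, Pi.smul_apply]
  · simp only [LinearMap.coe_mk, AddHom.coe_mk, setAverage_eq]
    have hb : ∀ᵐ t, t ∈ s → ‖L (torusConst E x) t‖ ≤ ‖L‖ * ‖x‖ := by
      filter_upwards [ae_volume_torus ▸ ae_norm_apply_torusConst_le hL x] with t ht _ using ht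
    have h1 := norm_setIntegral_le_of_norm_le_const_ae' (measure_lt_top volume s) hb
    rw [norm_smul, norm_inv, Real.norm_of_nonneg measureReal_nonneg]
    calc (volume.real s)⁻¹ * ‖∫ t in s, L (torusConst E x) t‖
        ≤ (volume.real s)⁻¹ * (‖L‖ * ‖x‖ * volume.real s) := by gcongr
      _ = ‖L‖ * ‖x‖ * ((volume.real s)⁻¹ * volume.real s) := by ring
      _ ≤ ‖L‖ * ‖x‖ * 1 := by
        gcongr
        exact inv_mul_le_one
      _ = _ := mul_one _

/-- Choosing a representative of `L x` for each `x` need not give something linear in `x`. Averages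
over balls are linear and bounded by `‖L‖`, and by Lebesgue differentiation they converge almost
everywhere. A countable dense set of vectors yields one null set serving all `x`. -/
theorem exists_symbol {L : L2Torus E →L[ℂ] L2Torus E}
    (hL : ∀ f, L (fourierMul 1 f) = fourierMul 1 (L f)) :
    ∃ φ : Torus → E →L[ℂ] E, (∀ t, ‖φ t‖ ≤ ‖L‖) ∧
      ∀ x, L (torusConst E x) =ᵐ[torusMeasure] fun t => φ t x := by
  classical
  choose A hA hAx using fun (t : Torus) (n : ℕ) =>
    exists_clm_eq_average hL (Metric.closedBall t (1 / ((n : ℝ) + 1)))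
  have hlim : ∀ x : E, ∀ᵐ t ∂torusMeasure,
      Tendsto (fun n => A t n x) atTop (𝓝 (L (torusConst E x) t)) := by
    intro x
    have := IsUnifLocDoublingMeasure.ae_tendsto_average (μ := (volume : Measure Torus))
      (integrable_coeFn (L (torusConst E x))).volume_torus.locallyIntegrable 1
    rw [ae_volume_torus] at this
    filter_upwards [this] with t ht
    simp only [hAx]
    refine ht (fun _ => t) (fun n : ℕ => 1 / ((n : ℝ) + 1)) ?_ ?_
    · refine tendsto_nhdsWithin_iff.2 ⟨tendsto_one_div_add_atTop_nhds_zero_nat, ?_⟩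
      exact Eventually.of_forall fun n => Set.mem_Ioi.2 Nat.one_div_pos_of_nat
    · exact Eventually.of_forall fun n => Metric.mem_closedBall_self (by positivity)
  -- At points without a strong limit the symbol is set to `0`, so the norm bound holds at every
  -- `t`.
  have hex : ∀ t, ∃ B : E →L[ℂ] E, ‖B‖ ≤ ‖L‖ ∧
      ((∃ B' : E →L[ℂ] E, ‖B'‖ ≤ ‖L‖ ∧ ∀ x, Tendsto (fun n => A t n x) atTop (𝓝 (B' x))) →
        ∀ x, Tendsto (fun n => A t n x) atTop (𝓝 (B x))) := by
    intro t
    by_cases h : ∃ B' : E →L[ℂ] E, ‖B'‖ ≤ ‖L‖ ∧ ∀ x, Tendsto (fun n => A t n x) atTop (𝓝 (B' x))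
    · obtain ⟨B, hB, hB'⟩ := h
      exact ⟨B, hB, fun _ => hB'⟩
    · exact ⟨0, by simp, fun h' => absurd h' h⟩
  choose φ hφ hφ' using hex
  refine ⟨φ, hφ, fun x => ?_⟩
  have hdense : ∀ᵐ t ∂torusMeasure, ∀ n : ℕ,
      ∃ y, Tendsto (fun k => A t k (TopologicalSpace.denseSeq E n)) atTop (𝓝 y) :=
    ae_all_iff.2 fun n => (hlim _).mono fun t ht => ⟨_, ht⟩
  filter_upwards [hdense, hlim x] with t h1 h2
  refine tendsto_nhds_unique h2 (hφ' t ?_ x)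
  exact exists_clm_tendsto_of_dense (hA t) (TopologicalSpace.denseRange_denseSeq E)
    (Set.forall_mem_range.2 h1)

/-- An operator commuting with multiplication by `e^{it}` is a Laurent operator, and its adjoint is
the Laurent operator of the adjoint symbol. -/
theorem isLaurent_of_symbol {L : L2Torus E →L[ℂ] L2Torus E}
    (hL : ∀ f, L (fourierMul 1 f) = fourierMul 1 (L f)) {φ : Torus → E →L[ℂ] E}
    (hφ : ∀ x, L (torusConst E x) =ᵐ[torusMeasure] fun t => φ t x) :
    IsLaurent φ L ∧ IsLaurent (fun t => adjoint (φ t)) (adjoint L) := by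
  -- Only the values of `L` on constants are known. Pairing with them determines `adjoint L`
  -- everywhere, and its values on constants then determine `L` everywhere.
  have hadj : ∀ v : L2Torus E,
      (adjoint L v : Torus → E) =ᵐ[torusMeasure] fun t => adjoint (φ t) (v t) := by
    intro v
    symm
    refine ae_eq_of_forall_inner_left fun y => ?_
    filter_upwards [ae_inner_apply_eq_inner_adjoint hL (torusConst E y) v, hφ y,
      coeFn_torusConst y] with t h1 h2 h3
    rw [h2, h3] at h1
    rw [adjoint_inner_left, ← inner_conj_symm, h1, inner_conj_symm]
  refine ⟨fun u => ae_eq_of_forall_inner_left fun y => ?_, hadj⟩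
  filter_upwards [ae_inner_apply_eq_inner_adjoint hL u (torusConst E y), hadj (torusConst E y),
    coeFn_torusConst y] with t h1 h2 h3
  rw [h2, h3] at h1
  rw [h1, adjoint_inner_right]

omit [CompleteSpace E] in
/-- Two Laurent operators commute only if their symbols commute almost everywhere. -/
theorem ae_commute_of_commute {S T : L2Torus E →L[ℂ] L2Torus E} {φ ψ : Torus → E →L[ℂ] E}
    (hφ : IsLaurent φ S) (hψ : IsLaurent ψ T) (h : Commute S T) :
    ∀ᵐ t ∂torusMeasure, Commute (φ t) (ψ t) := by
  have key : ∀ n : ℕ, ∀ᵐ t ∂torusMeasure, φ t (ψ t (TopologicalSpace.denseSeq E n))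
      = ψ t (φ t (TopologicalSpace.denseSeq E n)) := by
    intro n
    set x := TopologicalSpace.denseSeq E n
    have hST : S (T (torusConst E x)) = T (S (torusConst E x)) := DFunLike.congr_fun h.eq _
    filter_upwards [hφ (T (torusConst E x)), hψ (S (torusConst E x)), hφ (torusConst E x),
      hψ (torusConst E x), coeFn_torusConst x] with t h1 h2 h3 h4 h5
    rw [hST, h2, h3, h4, h5] at h1
    exact h1.symm
  filter_upwards [ae_all_iff.2 key] with t ht
  refine ContinuousLinearMap.ext fun x => ?_
  exact congr_fun (Continuous.ext_on (TopologicalSpace.denseRange_denseSeq E)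
    ((φ t) ∘L (ψ t)).continuous ((ψ t) ∘L (φ t)).continuous (Set.forall_mem_range.2 ht)) x

end Laurent

/-! ### Compact operators on weakly null sequences, and contractivity from normality. -/

/-- A compact operator maps bounded weakly null sequences to norm null sequences. -/
theorem IsCompactOperator.tendsto_zero_of_weakly_null {H : Type*} [NormedAddCommGroup H]
    [InnerProductSpace ℂ H] [CompleteSpace H] {K : H →L[ℂ] H} (hK : IsCompactOperator K)
    {x : ℕ → H} {C : ℝ} (hx : ∀ n, ‖x n‖ ≤ C)
    (hweak : ∀ z, Tendsto (fun n => inner ℂ z (x n)) atTop (𝓝 0)) :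
    Tendsto (fun n => K (x n)) atTop (𝓝 0) := by
  have hcomp : IsCompact (closure (K '' Metric.closedBall 0 C)) :=
    IsCompactOperator.isCompact_closure_image_closedBall (f := (K : H →ₗ[ℂ] H)) hK C
  -- In a compact set it suffices that `0` is the only cluster point; a cluster point `y` has `⟨y,
  -- y⟩ = lim ⟨K^* y, x n⟩ = 0`.
  refine hcomp.tendsto_nhds_of_unique_mapClusterPt (Eventually.of_forall fun n =>
    subset_closure ⟨x n, by simpa using hx n, rfl⟩) fun y _ hy => ?_
  obtain ⟨ψ, hψ, hlim⟩ := hy.tendsto_subseq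
  have h1 : Tendsto (fun n => inner ℂ y (K (x (ψ n)))) atTop (𝓝 (inner ℂ y y)) :=
    tendsto_const_nhds.inner hlim
  have h2 : Tendsto (fun n => inner ℂ y (K (x n))) atTop (𝓝 0) := by
    simpa only [adjoint_inner_left] using hweak (adjoint K y)
  have h3 : inner ℂ y y = (0 : ℂ) := tendsto_nhds_unique h1 (h2.comp hψ.tendsto_atTop)
  exact inner_self_eq_zero.1 h3

/-- If `b < a`, the powers of `b / a` decay to zero and defeat any constant `C`. -/
theorem le_of_forall_pow_succ_le_mul_pow_succ {a b C : ℝ} (hb : 0 ≤ b)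
    (h : ∀ n : ℕ, a ^ (n + 1) ≤ C * b ^ (n + 1)) : a ≤ b := by
  by_contra! hab
  have ha' : 0 < a := hb.trans_lt hab
  have hlim : Tendsto (fun n : ℕ => C * (b / a) ^ (n + 1)) atTop (𝓝 (C * 0)) :=
    ((tendsto_pow_atTop_nhds_zero_of_lt_one (by positivity) ((div_lt_one ha').2 hab)).comp
      (tendsto_add_atTop_nat 1)).const_mul C
  have hone : (1 : ℝ) ≤ C * 0 := ge_of_tendsto' hlim fun n => by
    rw [div_pow, mul_div_assoc', le_div_iff₀ (by positivity), one_mul]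
    exact h n
  norm_num at hone

/-- The norm of a normal element is its spectral radius, which is bounded by roots of the norms of
powers. The factor `‖1‖` allows for the trivial algebra. -/
theorem IsStarNormal.norm_pow_succ_le {A : Type*} [CStarAlgebra A] {a : A}
    (ha : IsStarNormal a) (n : ℕ) : ‖a‖ ^ (n + 1) ≤ ‖a ^ (n + 1)‖ * ‖(1 : A)‖ := by
  have h := spectrum.spectralRadius_le_pow_nnnorm_pow_one_div ℂ a n
  rw [IsStarNormal.spectralRadius_eq_nnnorm] at h
  have h2 := pow_le_pow_left' h (n + 1)
  have hn : ((n + 1 : ℕ) : ℝ) ≠ 0 := by positivity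
  have hroot : ∀ z : ENNReal, (z ^ (1 / (n + 1) : ℝ)) ^ (n + 1) = z := fun z => by
    rw [← ENNReal.rpow_natCast, ← ENNReal.rpow_mul]
    push_cast at hn ⊢
    rw [one_div_mul_cancel hn, ENNReal.rpow_one]
  rw [mul_pow, hroot, hroot] at h2
  exact_mod_cast h2

/-- A bounded unital homomorphism of a normed algebra into a C*-algebra whose values are normal is
contractive. -/
theorem norm_map_le_of_isStarNormal {B A : Type*} [NormedRing B] [NormedAlgebra ℂ B]
    [CStarAlgebra A] (F : B →ₐ[ℂ] A) {C : ℝ} (hF : ∀ b, ‖F b‖ ≤ C * ‖b‖)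
    (hn : ∀ b, IsStarNormal (F b)) (b : B) : ‖F b‖ ≤ ‖b‖ := by
  refine le_of_forall_pow_succ_le_mul_pow_succ (C := |C| * ‖(1 : A)‖) (norm_nonneg _) fun n => ?_
  calc ‖F b‖ ^ (n + 1) ≤ ‖F b ^ (n + 1)‖ * ‖(1 : A)‖ := (hn b).norm_pow_succ_le n
    _ = ‖F (b ^ (n + 1))‖ * ‖(1 : A)‖ := by rw [map_pow]
    _ ≤ |C| * ‖b‖ ^ (n + 1) * ‖(1 : A)‖ := by
      gcongr
      calc ‖F (b ^ (n + 1))‖ ≤ C * ‖b ^ (n + 1)‖ := hF _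
        _ ≤ |C| * ‖b ^ (n + 1)‖ := by gcongr; exact le_abs_self C
        _ ≤ |C| * ‖b‖ ^ (n + 1) := by gcongr; exact norm_pow_le' b n.succ_pos
    _ = _ := by ring

/-! ### Extending operators that commute with the shift, and normality of the extension. -/

section Extension

variable {H E : Type*} [NormedAddCommGroup H] [InnerProductSpace ℂ H] [NormedAddCommGroup E]
  [InnerProductSpace ℂ E]

theorem map_iterate_eq_fourierMul {U : H →ₗᵢ[ℂ] H} {Ψ : H →ₗᵢ[ℂ] L2Torus E}
    (hΨ : ∀ h, Ψ (U h) = fourierMul 1 (Ψ h)) (k : ℕ) (h : H) :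
    Ψ (U^[k] h) = fourierMul k (Ψ h) := by
  induction k with
  | zero => simp
  | succ k ih =>
    rw [Function.iterate_succ_apply', hΨ, ih, ← fourierMul_add]
    congr 2
    push_cast
    ring

theorem apply_iterate_of_commute {U : H →ₗᵢ[ℂ] H} {T : H →L[ℂ] H} (hT : ∀ h, T (U h) = U (T h))
    (k : ℕ) (h : H) : T (U^[k] h) = U^[k] (T h) :=
  Function.Commute.iterate_right (f := T) (g := U) hT k h

theorem norm_iterate (U : H →ₗᵢ[ℂ] H) (k : ℕ) (h : H) : ‖U^[k] h‖ = ‖h‖ := by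
  induction k with
  | zero => rfl
  | succ k ih => rw [Function.iterate_succ_apply', U.norm_map, ih]

/-- The translates of the range of `Ψ` under negative powers of `e^{it}`. -/
def negShifts (Ψ : H →ₗᵢ[ℂ] L2Torus E) : Set (L2Torus E) :=
  {f | ∃ (m : ℕ) (h : H), f = fourierMul (-m) (Ψ h)}

/-- `L` extends `T`, transported by `Ψ`, compatibly with multiplication by powers of `e^{it}`. -/
def IsShiftExtension (Ψ : H →ₗᵢ[ℂ] L2Torus E) (T : H →L[ℂ] H)
    (L : L2Torus E →L[ℂ] L2Torus E) : Prop :=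
  ∀ (m : ℕ) (h : H), L (fourierMul (-m) (Ψ h)) = fourierMul (-m) (Ψ (T h))

namespace IsShiftExtension

variable {Ψ : H →ₗᵢ[ℂ] L2Torus E} {T T' : H →L[ℂ] H} {L L' : L2Torus E →L[ℂ] L2Torus E}

theorem unique (hd : Dense (negShifts Ψ)) (h : IsShiftExtension Ψ T L)
    (h' : IsShiftExtension Ψ T L') : L = L' := by
  refine ContinuousLinearMap.ext fun f => congr_fun (Continuous.ext_on hd L.continuous
    L'.continuous ?_) f
  rintro _ ⟨m, g, rfl⟩
  rw [h m g, h' m g]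

theorem apply_map (h : IsShiftExtension Ψ T L) (g : H) : L (Ψ g) = Ψ (T g) := by
  simpa using h 0 g

theorem smul_one (c : ℂ) : IsShiftExtension Ψ (c • (1 : H →L[ℂ] H)) (c • 1) := fun m g => by
  simp

theorem mul (h : IsShiftExtension Ψ T L) (h' : IsShiftExtension Ψ T' L') :
    IsShiftExtension Ψ (T * T') (L * L') := fun m g => by
  rw [mul_apply_eq_comp, mul_apply_eq_comp, h', h]

theorem add (h : IsShiftExtension Ψ T L) (h' : IsShiftExtension Ψ T' L') :
    IsShiftExtension Ψ (T + T') (L + L') := fun m g => by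
  simp [h m g, h' m g]

theorem commute_fourierMul_one {U : H →ₗᵢ[ℂ] H} (hΨ : ∀ h, Ψ (U h) = fourierMul 1 (Ψ h))
    (hd : Dense (negShifts Ψ)) (hT : ∀ h, T (U h) = U (T h)) (h : IsShiftExtension Ψ T L)
    (f : L2Torus E) : L (fourierMul 1 f) = fourierMul 1 (L f) := by
  refine congr_fun (Continuous.ext_on hd (L.continuous.comp (fourierMul 1).continuous)
    ((fourierMul 1).continuous.comp L.continuous) ?_) f
  rintro _ ⟨m, g, rfl⟩
  have hcomm : ∀ k : L2Torus E, fourierMul 1 (fourierMul (-m) k)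
      = fourierMul (-m : ℤ) (fourierMul 1 k) := fun k => by
    rw [← fourierMul_add, ← fourierMul_add, add_comm]
  simp only [Function.comp_apply]
  rw [hcomm, ← hΨ, h, hT, hΨ, h, hcomm]

end IsShiftExtension

variable [CompleteSpace H] [CompleteSpace E]

theorem adjoint_toContinuousLinearMap_apply (Ψ : H →ₗᵢ[ℂ] L2Torus E) (h : H) :
    adjoint Ψ.toContinuousLinearMap (Ψ h) = h := by
  refine ext_inner_right ℂ fun g => ?_
  rw [adjoint_inner_left]
  exact Ψ.inner_map_map h g

/-- The compression of `T` to the translate by `e^{-ikt}` of the range of `Ψ`. -/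
noncomputable def shiftConj (Ψ : H →ₗᵢ[ℂ] L2Torus E) (T : H →L[ℂ] H) (k : ℕ) :
    L2Torus E →L[ℂ] L2Torus E :=
  (fourierMul (-k)).toContinuousLinearMap ∘L Ψ.toContinuousLinearMap ∘L T ∘L
    adjoint Ψ.toContinuousLinearMap ∘L (fourierMul k).toContinuousLinearMap

theorem shiftConj_apply (Ψ : H →ₗᵢ[ℂ] L2Torus E) (T : H →L[ℂ] H) (k : ℕ) (f : L2Torus E) :
    shiftConj Ψ T k f
      = fourierMul (-k) (Ψ (T (adjoint Ψ.toContinuousLinearMap (fourierMul k f)))) :=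
  rfl

theorem norm_shiftConj_le (Ψ : H →ₗᵢ[ℂ] L2Torus E) (T : H →L[ℂ] H) (k : ℕ) :
    ‖shiftConj Ψ T k‖ ≤ ‖T‖ := by
  refine opNorm_le_bound _ (norm_nonneg _) fun f => ?_
  rw [shiftConj_apply, LinearIsometry.norm_map, LinearIsometry.norm_map]
  refine (T.le_opNorm _).trans ?_
  gcongr
  refine (le_opNorm _ _).trans ?_
  rw [LinearIsometryEquiv.norm_map, LinearIsometry.norm_map]
  exact mul_le_of_le_one_left (norm_nonneg _) Ψ.norm_toContinuousLinearMap_le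

theorem shiftConj_fourierMul_neg {U : H →ₗᵢ[ℂ] H} {Ψ : H →ₗᵢ[ℂ] L2Torus E}
    (hΨ : ∀ h, Ψ (U h) = fourierMul 1 (Ψ h)) {T : H →L[ℂ] H} (hT : ∀ h, T (U h) = U (T h))
    {m k : ℕ} (hmk : m ≤ k) (h : H) :
    shiftConj Ψ T k (fourierMul (-m) (Ψ h)) = fourierMul (-m) (Ψ (T h)) := by
  obtain ⟨j, rfl⟩ := Nat.exists_eq_add_of_le hmk
  rw [shiftConj_apply, ← fourierMul_add,
    show ((m + j : ℕ) : ℤ) + -(m : ℤ) = j by push_cast; ring,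
    ← map_iterate_eq_fourierMul hΨ, adjoint_toContinuousLinearMap_apply,
    apply_iterate_of_commute hT, map_iterate_eq_fourierMul hΨ, ← fourierMul_add]
  congr 2
  push_cast
  ring

/-- On `e^{-imt} Ψ h` the compressions `shiftConj Ψ T k` are constant from `k = m` on, and they are
bounded by `‖T‖`, so they converge strongly. -/
theorem exists_isShiftExtension {U : H →ₗᵢ[ℂ] H} {Ψ : H →ₗᵢ[ℂ] L2Torus E}
    (hΨ : ∀ h, Ψ (U h) = fourierMul 1 (Ψ h)) (hd : Dense (negShifts Ψ)) {T : H →L[ℂ] H}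
    (hT : ∀ h, T (U h) = U (T h)) :
    ∃ L : L2Torus E →L[ℂ] L2Torus E, IsShiftExtension Ψ T L ∧ ‖L‖ ≤ ‖T‖ ∧
      ∀ f, Tendsto (fun k => shiftConj Ψ T k f) atTop (𝓝 (L f)) := by
  have hconst : ∀ (m : ℕ) (h : H), Tendsto (fun k => shiftConj Ψ T k (fourierMul (-m) (Ψ h)))
      atTop (𝓝 (fourierMul (-m) (Ψ (T h)))) := fun m h =>
    tendsto_const_nhds.congr' ((eventually_ge_atTop m).mono fun k hk =>
      (shiftConj_fourierMul_neg hΨ hT hk h).symm)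
  obtain ⟨L, hL, hlim⟩ := exists_clm_tendsto_of_dense (norm_shiftConj_le Ψ T) hd (by
    rintro _ ⟨m, h, rfl⟩
    exact ⟨_, hconst m h⟩)
  exact ⟨L, fun m h => tendsto_nhds_unique (hlim _) (hconst m h), hL, hlim⟩

/-- For `T = 1` the compressions are the projections onto `e^{-ikt} Ψ H`, which tend strongly to the
identity. -/
theorem tendsto_norm_adjoint_fourierMul {U : H →ₗᵢ[ℂ] H} {Ψ : H →ₗᵢ[ℂ] L2Torus E}
    (hΨ : ∀ h, Ψ (U h) = fourierMul 1 (Ψ h)) (hd : Dense (negShifts Ψ)) (f : L2Torus E) :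
    Tendsto (fun k : ℕ => ‖adjoint Ψ.toContinuousLinearMap (fourierMul k f)‖) atTop
      (𝓝 ‖f‖) := by
  obtain ⟨L, hL, -, hlim⟩ := exists_isShiftExtension hΨ hd (T := 1) fun _ => rfl
  have h1 : L = 1 := hL.unique hd (by simpa using IsShiftExtension.smul_one (Ψ := Ψ) 1)
  have h2 := (hlim f).norm
  rw [h1] at h2
  simpa [shiftConj_apply] using h2

/-- The extension of an essentially normal operator commuting with a shift is normal. -/
theorem IsShiftExtension.isStarNormal {U : H →ₗᵢ[ℂ] H} {Ψ : H →ₗᵢ[ℂ] L2Torus E}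
    (hΨ : ∀ h, Ψ (U h) = fourierMul 1 (Ψ h)) (hd : Dense (negShifts Ψ))
    (hweak : ∀ h z, Tendsto (fun k => inner ℂ z (U^[k] h)) atTop (𝓝 0)) {T : H →L[ℂ] H}
    (hT : ∀ h, T (U h) = U (T h))
    (hcomp : IsCompactOperator (adjoint T * T - T * adjoint T : H →L[ℂ] H))
    {L : L2Torus E →L[ℂ] L2Torus E} (hL : IsShiftExtension Ψ T L) : IsStarNormal L := by
  have hW := hL.commute_fourierMul_one hΨ hd hT
  have hadj : ∀ f, adjoint Ψ.toContinuousLinearMap (adjoint L f)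
      = adjoint T (adjoint Ψ.toContinuousLinearMap f) := fun f => by
    refine ext_inner_right ℂ fun g => ?_
    rw [adjoint_inner_left, adjoint_inner_left, adjoint_inner_left, adjoint_inner_left]
    exact congr_arg _ (hL.apply_map g)
  have hrange : ∀ h, ‖L (Ψ h)‖ = ‖adjoint L (Ψ h)‖ := by
    intro h
    -- By `hadj`, `T^* U^k h = Ψ^* (e^{ikt} L^* Ψ h)`, whose norm tends to `‖L^* Ψ h‖`.
    have h1 : Tendsto (fun k => ‖adjoint T (U^[k] h)‖ ^ 2) atTop (𝓝 (‖adjoint L (Ψ h)‖ ^ 2)) := by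
      refine ((tendsto_norm_adjoint_fourierMul hΨ hd (adjoint L (Ψ h))).pow 2).congr fun k => ?_
      rw [← adjoint_commute_fourierMul hW, hadj, ← map_iterate_eq_fourierMul hΨ,
        adjoint_toContinuousLinearMap_apply]
    -- The difference of squares is the quadratic form of the compact self-commutator at the weakly
    -- null sequence `U^k h`.
    have h2 : Tendsto (fun k => ‖T (U^[k] h)‖ ^ 2 - ‖adjoint T (U^[k] h)‖ ^ 2) atTop (𝓝 0) := by
      have h3 := hcomp.tendsto_zero_of_weakly_null (x := fun k => U^[k] h)
        (fun k => (norm_iterate U k h).le) (hweak h)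
      refine squeeze_zero_norm (fun k => ?_) (by simpa using h3.norm.mul_const ‖h‖)
      have h4 : ((‖T (U^[k] h)‖ ^ 2 - ‖adjoint T (U^[k] h)‖ ^ 2 : ℝ) : ℂ)
          = inner ℂ ((adjoint T * T - T * adjoint T : H →L[ℂ] H) (U^[k] h)) (U^[k] h) := by
        rw [sub_apply, inner_sub_left, mul_apply_eq_comp, mul_apply_eq_comp, adjoint_inner_left,
          ← adjoint_inner_right T (adjoint T (U^[k] h)), inner_self_eq_norm_sq_to_K, inner_self_eq_norm_sq_to_K]
        push_cast
        rfl
      rw [← norm_iterate U k h, ← Complex.norm_real, h4]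
      exact norm_inner_le_norm _ _
    have h5 : ∀ k, ‖T (U^[k] h)‖ ^ 2 = ‖L (Ψ h)‖ ^ 2 := fun k => by
      rw [apply_iterate_of_commute hT, norm_iterate, hL.apply_map, LinearIsometry.norm_map]
    simp only [h5] at h2
    have h6 := tendsto_nhds_unique h2 (tendsto_const_nhds.sub h1)
    exact (sq_eq_sq₀ (norm_nonneg _) (norm_nonneg _)).1 (sub_eq_zero.1 h6.symm)
  refine isStarNormal_iff_norm_eq_adjoint.2 fun f => ?_
  refine congr_fun (Continuous.ext_on hd (f := fun f => ‖L f‖) (g := fun f => ‖adjoint L f‖)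
    L.continuous.norm (adjoint L).continuous.norm ?_) f
  rintro _ ⟨m, h, rfl⟩
  simp only
  rw [commute_fourierMul hW, adjoint_commute_fourierMul hW, LinearIsometry.norm_map,
    LinearIsometry.norm_map, hrange]

end Extension

/-! ### Wold decomposition of a pure isometry. -/

section Wold

variable {H : Type*} [NormedAddCommGroup H] [InnerProductSpace ℂ H]

/-- The isometry `e ↦ U^k e` on the wandering subspace of `U`. -/
noncomputable def wanderingShift (U : H →ₗᵢ[ℂ] H) : ℕ → wanderingSubspace U →ₗᵢ[ℂ] H
  | 0 => (wanderingSubspace U).subtypeₗᵢ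
  | k + 1 => U.comp (wanderingShift U k)

theorem wanderingShift_apply (U : H →ₗᵢ[ℂ] H) (k : ℕ) (e : wanderingSubspace U) :
    wanderingShift U k e = U^[k] e := by
  induction k with
  | zero => rfl
  | succ k ih => rw [Function.iterate_succ_apply', ← ih]; rfl

theorem inner_iterate_iterate (U : H →ₗᵢ[ℂ] H) (k : ℕ) (x y : H) :
    inner ℂ (U^[k] x) (U^[k] y) = inner ℂ x y := by
  induction k with
  | zero => rfl
  | succ k ih => rw [Function.iterate_succ_apply', Function.iterate_succ_apply', U.inner_map_map, ih]

theorem inner_wanderingShift_iterate_of_lt (U : H →ₗᵢ[ℂ] H) {i j : ℕ} (hij : i < j)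
    (x : wanderingSubspace U) (y : H) : inner ℂ (wanderingShift U i x) (U^[j] y) = 0 := by
  obtain ⟨d, rfl⟩ := Nat.exists_eq_add_of_lt hij
  rw [wanderingShift_apply, add_assoc, Function.iterate_add_apply, inner_iterate_iterate,
    Function.iterate_succ_apply']
  exact Submodule.inner_left_of_mem_orthogonal (LinearMap.mem_range_self U.toLinearMap _) x.2

theorem orthogonalFamily_wanderingShift (U : H →ₗᵢ[ℂ] H) :
    OrthogonalFamily ℂ (fun _ : ℕ => wanderingSubspace U) (wanderingShift U) := by
  intro i j hij x y
  rcases lt_or_gt_of_ne hij with h | h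
  · simp only [wanderingShift_apply U j]
    exact inner_wanderingShift_iterate_of_lt U h x y
  · rw [← inner_conj_symm, wanderingShift_apply U i, inner_wanderingShift_iterate_of_lt U h,
      map_zero]

variable [CompleteSpace H]

/-- Let `h` be orthogonal to every `U^k E`. If `h = U^k g`, then `g` is orthogonal to `E`, hence
lies in the closed range of `U`, and `h` lies in the range of `U^(k+1)`. By induction `h` lies in
all the ranges, so purity gives `h = 0`. -/
theorem topologicalClosure_iSup_range_wanderingShift {U : H →ₗᵢ[ℂ] H}
    (hpure : ⋂ k : ℕ, Set.range (U^[k]) = {0}) :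
    (⨆ k, LinearMap.range (wanderingShift U k).toLinearMap).topologicalClosure = ⊤ := by
  rw [Submodule.topologicalClosure_eq_top_iff, Submodule.eq_bot_iff]
  intro h hh
  have horth : ∀ (k : ℕ) (e : wanderingSubspace U), inner ℂ (U^[k] (e : H)) h = 0 := fun k e => by
    rw [← wanderingShift_apply]
    exact Submodule.inner_right_of_mem_orthogonal
      (Submodule.mem_iSup_of_mem k (LinearMap.mem_range_self _ e)) hh
  have hcl : IsClosed ((LinearMap.range U.toLinearMap : Submodule ℂ H) : Set H) := by
    exact U.isometry.isClosedEmbedding.isClosed_range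
  have hmem : ∀ k : ℕ, h ∈ Set.range (U^[k]) := by
    intro k
    induction k with
    | zero => exact ⟨h, rfl⟩
    | succ k ih =>
      obtain ⟨g, hg⟩ := ih
      have hgr : g ∈ (LinearMap.range U.toLinearMap)ᗮᗮ := by
        refine (Submodule.mem_orthogonal _ _).2 fun e he => ?_
        rw [← inner_iterate_iterate U k, hg]
        exact horth k ⟨e, he⟩
      rw [Submodule.orthogonal_orthogonal_eq_closure, hcl.submodule_topologicalClosure_eq] at hgr
      obtain ⟨g', rfl⟩ := hgr
      exact ⟨g', by rw [Function.iterate_succ_apply]; exact hg⟩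
  have : h ∈ ⋂ k : ℕ, Set.range (U^[k]) := Set.mem_iInter.2 hmem
  rw [hpure] at this
  exact this

theorem isHilbertSum_wanderingShift {U : H →ₗᵢ[ℂ] H}
    (hpure : ⋂ k : ℕ, Set.range (U^[k]) = {0}) :
    IsHilbertSum ℂ (fun _ : ℕ => wanderingSubspace U) (wanderingShift U) :=
  IsHilbertSum.mk (orthogonalFamily_wanderingShift U)
    (topologicalClosure_iSup_range_wanderingShift hpure).ge

/-- For `z` in `U^m E` the inner product vanishes once `k > m`; such vectors span a dense subspace
and the norms of `U^k h` are constant. -/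
theorem tendsto_inner_iterate_zero {U : H →ₗᵢ[ℂ] H}
    (hpure : ⋂ k : ℕ, Set.range (U^[k]) = {0}) (h z : H) :
    Tendsto (fun k => inner ℂ z (U^[k] h)) atTop (𝓝 0) := by
  let S : Submodule ℂ H :=
    { carrier := {z | Tendsto (fun k => inner ℂ (U^[k] h) z) atTop (𝓝 0)}
      add_mem' := fun ha hb => by
        simpa only [Set.mem_ofPred_eq, inner_add_right, add_zero] using ha.add hb
      zero_mem' := by simp
      smul_mem' := fun c a ha => by
        simpa only [Set.mem_ofPred_eq, inner_smul_right, mul_zero] using ha.const_mul c }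
  have hS : Dense (S : Set H) := by
    rw [Submodule.dense_iff_topologicalClosure_eq_top, eq_top_iff,
      ← topologicalClosure_iSup_range_wanderingShift hpure]
    refine Submodule.topologicalClosure_mono (iSup_le fun m => ?_)
    rintro _ ⟨e, rfl⟩
    refine tendsto_const_nhds.congr' ((eventually_gt_atTop m).mono fun k hk => ?_)
    refine Eq.trans ?_ (inner_conj_symm _ _)
    refine (map_zero _).symm.trans (congr_arg _ ?_)
    exact (inner_wanderingShift_iterate_of_lt U hk e h).symm
  obtain ⟨B, -, hB⟩ := exists_clm_tendsto_of_dense (A := fun k => innerSL ℂ (U^[k] h)) (C := ‖h‖)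
    (fun k => by rw [innerSL_apply_norm, norm_iterate]) hS (fun x hx => ⟨0, hx⟩)
  have hB0 : B = 0 := ContinuousLinearMap.ext fun x => congr_fun (Continuous.ext_on hS B.continuous
    (0 : H →L[ℂ] ℂ).continuous fun x hx => tendsto_nhds_unique (hB x) hx) x
  have h1 := (Complex.continuous_conj.tendsto _).comp (hB z)
  rw [hB0, zero_apply, map_zero] at h1
  refine h1.congr fun k => ?_
  exact inner_conj_symm _ _

end Wold

/-! ### The Hardy space as the closed span of the nonnegative monomials. -/

section Hardy

variable {E : Type*} [NormedAddCommGroup E] [InnerProductSpace ℂ E] [CompleteSpace E]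

theorem eq_zero_of_forall_fourierCoeff_eq_zero [SecondCountableTopology E] {f : L2Torus E}
    (h : ∀ k, fourierCoeff (f : Torus → E) k = 0) : f = 0 := by
  ext1
  refine EventuallyEq.trans ?_ (Lp.coeFn_zero E 2 torusMeasure).symm
  refine ae_eq_of_forall_inner_left fun y => ?_
  have h1 := ae_eq_zero_of_fourierCoeff_eq_zero
    (L2.integrable_inner (𝕜 := ℂ) f (torusConst E y)) fun m => by
      rw [← inner_fourierMul_left_eq_fourierCoeff, inner_fourierMul_left, ← inner_conj_symm]
      have := inner_torusMonomial (-m) y f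
      rw [h, inner_zero_right] at this
      exact (congr_arg _ this).trans (map_zero _)
  filter_upwards [h1, coeFn_torusConst y] with t h2 h3
  rw [h3] at h2
  simpa using h2

theorem mem_topologicalClosure_iSup_range_torusMonomial_iff [SecondCountableTopology E]
    (f : L2Torus E) :
    f ∈ (⨆ k : ℕ, LinearMap.range (torusMonomial (E := E) (k : ℤ)).toLinearMap).topologicalClosure
      ↔ IsHardy f := by
  set S := ⨆ k : ℕ, LinearMap.range (torusMonomial (E := E) (k : ℤ)).toLinearMap with hS
  have hmem : ∀ (k : ℕ) (y : E), torusMonomial (k : ℤ) y ∈ S := fun k y =>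
    Submodule.mem_iSup_of_mem k (LinearMap.mem_range_self _ y)
  have hhardy : ∀ g ∈ S.topologicalClosure, IsHardy g := by
    intro g hg m hm
    refine ext_inner_left ℂ fun y => ?_
    have hle : S.topologicalClosure ≤ LinearMap.ker (innerSL ℂ (torusMonomial m y)).toLinearMap := by
      refine Submodule.topologicalClosure_minimal _ (iSup_le fun k => ?_)
        (innerSL ℂ (torusMonomial m y)).isClosed_ker
      rintro _ ⟨x, rfl⟩
      exact inner_torusMonomial_torusMonomial_of_ne (by omega) y x
    rw [inner_zero_right, ← inner_torusMonomial]
    exact hle hg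
  refine ⟨hhardy f, fun hf => ?_⟩
  have : CompleteSpace S.topologicalClosure := S.isClosed_topologicalClosure.completeSpace_coe
  obtain ⟨g, hg, r, hr, rfl⟩ := S.topologicalClosure.exists_add_mem_mem_orthogonal f
  -- The part `r` orthogonal to the span has no coefficients of index `k ≥ 0`; those of negative
  -- index vanish since both `g + r` and `g` are Hardy.
  have hr0 : r = 0 := by
    refine eq_zero_of_forall_fourierCoeff_eq_zero fun k => ?_
    rcases lt_or_ge k 0 with hk | hk
    · have h1 := fourierCoeff_sub_coeFn (g + r) g k
      rwa [add_sub_cancel_left, hf k hk, hhardy g hg k hk, sub_zero] at h1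
    · obtain ⟨j, rfl⟩ := Int.eq_ofNat_of_zero_le hk
      refine ext_inner_left ℂ fun y => ?_
      rw [inner_zero_right, ← inner_torusMonomial]
      exact Submodule.inner_right_of_mem_orthogonal
        (S.le_topologicalClosure (hmem j y)) hr
  rw [hr0, add_zero]
  exact hg

theorem isHardy_torusConst [SecondCountableTopology E] (x : E) : IsHardy (torusConst E x) := by
  refine (mem_topologicalClosure_iSup_range_torusMonomial_iff _).1 (Submodule.le_topologicalClosure _
    (Submodule.mem_iSup_of_mem 0 ⟨x, ?_⟩))
  exact fourierMul_zero _

end Hardy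

/-! ### The Hardy space model of a pure isometry. -/

section WoldModel

variable {H : Type*} [NormedAddCommGroup H] [InnerProductSpace ℂ H] [CompleteSpace H]

/-- The Wold decomposition of a pure isometry `U`: an isometry onto the Hardy space of its wandering
subspace, intertwining `U` with multiplication by `e^{it}`. -/
theorem exists_wold_isometry [SecondCountableTopology H] {U : H →ₗᵢ[ℂ] H}
    (hpure : ⋂ k : ℕ, Set.range (U^[k]) = {0}) :
    ∃ Ψ : H →ₗᵢ[ℂ] L2Torus (wanderingSubspace U), Set.range Ψ = {f | IsHardy f} ∧
      (∀ h, Ψ (U h) = fourierMul 1 (Ψ h)) ∧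
      ∀ e : wanderingSubspace U, Ψ (e : H) = torusConst _ e := by
  classical
  have hV := isHilbertSum_wanderingShift hpure
  have hW : OrthogonalFamily ℂ (fun _ : ℕ => wanderingSubspace U)
      fun k : ℕ => torusMonomial (k : ℤ) :=
    orthogonalFamily_torusMonomial.comp Nat.cast_injective
  let Ψ : H →ₗᵢ[ℂ] L2Torus (wanderingSubspace U) :=
    hW.linearIsometry.comp hV.linearIsometryEquiv.toLinearIsometry
  have hΨV : ∀ (k : ℕ) (e : wanderingSubspace U),
      Ψ (wanderingShift U k e) = torusMonomial (k : ℤ) e := fun k e => by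
    change hW.linearIsometry (hV.linearIsometryEquiv (wanderingShift U k e)) = _
    rw [← hV.linearIsometryEquiv_symm_apply_single, LinearIsometryEquiv.apply_symm_apply,
      hW.linearIsometry_apply_single]
  refine ⟨Ψ, ?_, fun h => ?_, fun e => ?_⟩
  · ext f
    rw [Set.mem_ofPred_eq, ← mem_topologicalClosure_iSup_range_torusMonomial_iff,
      ← hW.range_linearIsometry]
    constructor
    · rintro ⟨h, rfl⟩
      exact ⟨hV.linearIsometryEquiv h, rfl⟩
    · rintro ⟨g, rfl⟩
      exact ⟨hV.linearIsometryEquiv.symm g,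
        congr_arg hW.linearIsometry (hV.linearIsometryEquiv.apply_symm_apply g)⟩
  · let D : H →L[ℂ] L2Torus (wanderingSubspace U) :=
      Ψ.toContinuousLinearMap ∘L U.toContinuousLinearMap
        - (fourierMul 1).toContinuousLinearMap ∘L Ψ.toContinuousLinearMap
    have hle : (⨆ k, LinearMap.range (wanderingShift U k).toLinearMap).topologicalClosure
        ≤ LinearMap.ker D.toLinearMap := by
      refine Submodule.topologicalClosure_minimal _ (iSup_le fun k => ?_) D.isClosed_ker
      rintro _ ⟨e, rfl⟩
      change Ψ (wanderingShift U (k + 1) e) - fourierMul 1 (Ψ (wanderingShift U k e)) = 0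
      rw [hΨV, hΨV, fourierMul_torusMonomial, sub_eq_zero]
      congr 2
      push_cast
      ring
    rw [topologicalClosure_iSup_range_wanderingShift hpure] at hle
    exact sub_eq_zero.1 (hle (Submodule.mem_top (x := h)))
  · exact (hΨV 0 e).trans (fourierMul_zero _)

theorem dense_negShifts [SecondCountableTopology H] {U : H →ₗᵢ[ℂ] H}
    {Ψ : H →ₗᵢ[ℂ] L2Torus (wanderingSubspace U)} (hΨ : ∀ h, Ψ (U h) = fourierMul 1 (Ψ h))
    (hconst : ∀ e : wanderingSubspace U, Ψ (e : H) = torusConst _ e) : Dense (negShifts Ψ) := by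
  let S : Submodule ℂ (L2Torus (wanderingSubspace U)) :=
    { carrier := negShifts Ψ
      add_mem' := by
        rintro _ _ ⟨m, h, rfl⟩ ⟨m', h', rfl⟩
        -- The translates are nested, so both summands fit in the one with exponent `m + m'`.
        refine ⟨m + m', U^[m'] h + U^[m] h', ?_⟩
        rw [map_add, map_add, map_iterate_eq_fourierMul hΨ, map_iterate_eq_fourierMul hΨ,
          ← fourierMul_add, ← fourierMul_add]
        congr 3 <;> push_cast <;> ring
      zero_mem' := ⟨0, 0, by simp⟩
      smul_mem' := by
        rintro c _ ⟨m, h, rfl⟩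
        exact ⟨m, c • h, by rw [map_smul, map_smul]⟩ }
  change Dense (S : Set (L2Torus (wanderingSubspace U)))
  rw [Submodule.dense_iff_topologicalClosure_eq_top, Submodule.topologicalClosure_eq_top_iff,
    Submodule.eq_bot_iff]
  intro g hg
  refine eq_zero_of_forall_fourierCoeff_eq_zero fun k => ?_
  refine ext_inner_left ℂ fun y => ?_
  rw [inner_zero_right, ← inner_torusMonomial]
  -- Splitting `k` into positive and negative parts writes every monomial `e^{ikt} y`, of either
  -- sign, as a negative shift of `Ψ (U^j y)`.
  refine Submodule.inner_right_of_mem_orthogonal (K := S) ⟨(-k).toNat, U^[k.toNat] (y : H), ?_⟩ hg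
  rw [map_iterate_eq_fourierMul hΨ, hconst, ← fourierMul_add]
  change fourierMul k _ = _
  congr 2
  omega

end WoldModel

/-! ### The extended module and the main theorem. -/

/-- The extension of a Hilbert module commuting with a shift to the minimal unitary extension of
the shift. -/
theorem exists_hilbertModule_extension {n : ℕ} {Ω : BoundedDomain n} {H E : Type*}
    [NormedAddCommGroup H] [InnerProductSpace ℂ H] [CompleteSpace H] [NormedAddCommGroup E]
    [InnerProductSpace ℂ E] [CompleteSpace E] (R : HilbertModule Ω H) {U : H →ₗᵢ[ℂ] H}
    (hU : R.IsModuleMap R U) {Ψ : H →ₗᵢ[ℂ] L2Torus E}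
    (hΨ : ∀ h, Ψ (U h) = fourierMul 1 (Ψ h)) (hd : Dense (negShifts Ψ)) :
    ∃ N : HilbertModule Ω (L2Torus E), ∀ ψ, IsShiftExtension Ψ (R.act ψ) (N.act ψ) := by
  choose L hL hLnorm _ using fun ψ => exists_isShiftExtension hΨ hd (T := R.act ψ)
    (fun h => (hU ψ h).symm)
  have hscalar : ∀ c : ℂ, L (algebraMap ℂ (DomainAlgebra Ω) c) = c • 1 := fun c => by
    refine (hL _).unique hd ?_
    rw [AlgHom.commutes, Algebra.algebraMap_eq_smul_one]
    exact IsShiftExtension.smul_one c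
  have hone : L 1 = 1 := by simpa using hscalar 1
  have hzero : L 0 = 0 := by simpa using hscalar 0
  obtain ⟨C, hC⟩ := R.bounded
  exact ⟨{
    act :=
      { toFun := L
        map_one' := hone
        map_mul' := fun a b => (hL _).unique hd (by
          rw [map_mul]
          exact (hL a).mul (hL b))
        map_zero' := hzero
        map_add' := fun a b => (hL _).unique hd (by
          rw [map_add]
          exact (hL a).add (hL b))
        commutes' := fun c => (hscalar c).trans (Algebra.algebraMap_eq_smul_one c).symm }
    bounded := ⟨C, fun ψ => (hLnorm ψ).trans (hC ψ)⟩ }, hL⟩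

theorem HilbertModule.IsReductive.isContractive {n : ℕ} {Ω : BoundedDomain n} {H : Type*}
    [NormedAddCommGroup H] [InnerProductSpace ℂ H] [CompleteSpace H] {N : HilbertModule Ω H}
    (hN : N.IsReductive) : N.IsContractive := by
  obtain ⟨C, hC⟩ := N.bounded
  exact fun ψ f => (N.act ψ).le_of_opNorm_le (norm_map_le_of_isStarNormal N.act hC hN ψ) f

theorem mainTheorem6 {n : ℕ} (Ω : BoundedDomain n)
    {H : Type*} [NormedAddCommGroup H] [InnerProductSpace ℂ H] [CompleteSpace H]
    [TopologicalSpace.SeparableSpace H]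
    (R : HilbertModule Ω H) (hR : R.IsEssentiallyReductive)
    (U : H →ₗᵢ[ℂ] H) (hU : R.IsModuleMap R U)
    (hpure : ⋂ k : ℕ, Set.range (U^[k]) = {0}) :
    ∃ (N : HilbertModule Ω (L2Torus (wanderingSubspace U)))
      (Ψ : H →ₗᵢ[ℂ] L2Torus (wanderingSubspace U))
      (φ : Fin n → Torus → wanderingSubspace U →L[ℂ] wanderingSubspace U),
      -- `N` is a reductive (and contractive) Hilbert module, and `Ψ` embeds `R` as a submodule
      N.IsReductive ∧ N.IsContractive ∧ R.IsModuleMap N Ψ ∧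
      -- the submodule is the Hardy space, on which `U` is multiplication by `e^{it}`
      Set.range Ψ = {f | IsHardy f} ∧
      (∀ h : H, (Ψ (U h) : Torus → wanderingSubspace U)
        =ᵐ[torusMeasure] fun t => fourier 1 t • Ψ h t) ∧
      -- the coordinate functions act on `N` as the multiplication operators `L_{φ_i}`
      (∀ i, IsHInfty (φ i) ∧ IsLaurent (φ i) (N.act (coord Ω i))) ∧
      -- the values of the `φ_i` are commuting normal operators almost everywhere
      (∀ᵐ t ∂torusMeasure, ∀ i j, IsStarNormal (φ i t) ∧ Commute (φ i t) (φ j t)) := by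
  have : SecondCountableTopology H := UniformSpace.secondCountable_of_separable H
  obtain ⟨Ψ, hrange, hΨ, hconst⟩ := exists_wold_isometry hpure
  have hd := dense_negShifts hΨ hconst
  obtain ⟨N, hN⟩ := exists_hilbertModule_extension R hU hΨ hd
  have hcomm : ∀ ψ f, N.act ψ (fourierMul 1 f) = fourierMul 1 (N.act ψ f) := fun ψ =>
    (hN ψ).commute_fourierMul_one hΨ hd fun h => (hU ψ h).symm
  have hred : N.IsReductive := fun ψ =>
    (hN ψ).isStarNormal hΨ hd (tendsto_inner_iterate_zero hpure) (fun h => (hU ψ h).symm) (hR ψ)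
  choose φ hφ hφL using fun i => exists_symbol (hcomm (coord Ω i))
  have hLaurent := fun i => isLaurent_of_symbol (hcomm (coord Ω i)) (hφL i)
  refine ⟨N, Ψ, φ, hred, hred.isContractive, fun ψ f => ((hN ψ).apply_map f).symm, hrange,
    fun h => hΨ h ▸ coeFn_fourierMul 1 (Ψ h), fun i => ⟨⟨fun x => ?_, ?_, fun x m hm => ?_⟩,
      (hLaurent i).1⟩, ?_⟩
  · exact (Lp.aestronglyMeasurable _).congr (hφL i x)
  · exact ⟨_, Eventually.of_forall (hφ i)⟩
  · obtain ⟨h, hh⟩ : torusConst _ x ∈ Set.range Ψ := hrange ▸ isHardy_torusConst x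
    have h1 : IsHardy (N.act (coord Ω i) (torusConst _ x)) := by
      rw [← hh, (hN _).apply_map]
      exact hrange.subset (Set.mem_range_self _)
    rw [← fourierCoeff_congr_ae (hφL i x)]
    exact h1 m hm
  · refine ae_all_iff.2 fun i => ae_all_iff.2 fun j => ?_
    have hij : Commute (N.act (coord Ω i)) (N.act (coord Ω j)) :=
      (Commute.all (coord Ω i) (coord Ω j)).map N.act
    -- Normality of the values is commutation of the Laurent operator with its adjoint, whose symbol
    -- is the pointwise adjoint.
    filter_upwards [ae_commute_of_commute (hLaurent i).1 (hLaurent j).1 hij,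
      ae_commute_of_commute (hLaurent i).2 (hLaurent i).1 (hred (coord Ω i)).star_comm_self]
      with t h1 h2
    exact ⟨⟨h2⟩, h1⟩
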